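/- Logarithms are to base $2$. For $n$ jointly distributed random variables $\mathcal X=(X_1,\dots,X_n)$ with finite ranges, the entropy profile of $\mathcal X$ is the point $(H(X_S))_{\emptyset\ne S\subseteq\{1,\dots,n\}}\in\mathbb{R}^{2^n-1}$, where $X_S=(X_i)_{i\in S}$ and $H(X)=\sum_x p(x)\log\frac1{p(x)}$ is the Shannon entropy. A point of $\mathbb{R}^{2^n-1}$ is called entropic if it is the entropy profile of some such tuple, and almost entropic if it lies in the closure of the set of entropic points. A linear information inequality is a family of real coefficients $(\kappa_S)_{\emptyset\ne S\subseteq\{1,\dots,n\}}$ such that $\sum_S\kappa_S H(X_S)\ge 0$ for all such tuples $\mathcal X$; a point $h$ satisfies it if $\sum_S\kappa_S h_S\ge0$. Let $n=4$ and write $A,B,C,D$ for the four variables. For a point $h\in\mathbb{R}^{15}$ write $H(\cdot)$ for its coordinates and put $H(X|Y)=H(X,Y)-H(Y)$, $I(X:Y)=H(X)+H(Y)-H(X,Y)$, $I(X:Y|Z)=H(X,Z)+H(Y,Z)-H(X,Y,Z)-H(Z)$, and $$\square_{AB,CD}=I(C:D|A)+I(C:D|B)+I(A:B)-I(C:D).$$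 Consider the two conditional inequalities (I1) if $I(A:B|C)=I(A:B)=0$, then $\square_{AB,CD}\ge0$; (I3) if $I(A:B|C)=H(C|A,B)=0$, then $\square_{AB,CD}\ge0$. Theorem. Neither (I1) nor (I3) holds for all almost entropic points. That is, there is an almost entropic point in $\mathbb{R}^{15}$ that satisfies all linear information inequalities and for which $I(A:B|C)=I(A:B)=0$ but $\square_{AB,CD}<0$; and there is an almost entropic point in $\mathbb{R}^{15}$ that satisfies all linear information inequalities and for which $I(A:B|C)=H(C|A,B)=0$ but $\square_{AB,CD}<0$. -/

import Mathlib

noncomputable section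

open MeasureTheory

namespace InfoIneq

/-- A tuple of `n` jointly distributed discrete random variables with finite ranges:
`X i` is a measurable map from a probability space to a finite set. -/
structure RandomTuple (n : ℕ) where
  Ω : Type
  [mΩ : MeasurableSpace Ω]
  μ : Measure Ω
  [prob : IsProbabilityMeasure μ]
  α : Fin n → Type
  [finα : ∀ i, Fintype (α i)]
  X : ∀ i, Ω → α i
  measurable_fiber : ∀ i a, MeasurableSet (X i ⁻¹' {a})

attribute [instance] RandomTuple.mΩ RandomTuple.prob RandomTuple.finα

namespace RandomTuple

variable {n : ℕ}

/-- The sub-tuple `(X i)_{i ∈ S}`, as a single random variable. -/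
def sub (𝒳 : RandomTuple n) (S : Finset (Fin n)) : 𝒳.Ω → ∀ i : S, 𝒳.α i :=
  fun ω i => 𝒳.X i ω

/-- `Prob[(X i)_{i ∈ S} = x]`. -/
def prb (𝒳 : RandomTuple n) (S : Finset (Fin n)) (x : ∀ i : S, 𝒳.α i) : ℝ :=
  𝒳.μ.real (𝒳.sub S ⁻¹' {x})

/-- Shannon entropy, in bits, of the sub-tuple `(X i)_{i ∈ S}`. A value of probability `0`
contributes `0`. -/
def entropy (𝒳 : RandomTuple n) (S : Finset (Fin n)) : ℝ :=
  ∑ x : (∀ i : S, 𝒳.α i), 𝒳.prb S x * Real.logb 2 (1 / 𝒳.prb S x)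

end RandomTuple

/-- The space of dimension `2 ^ n - 1` whose coordinates are indexed by the non-empty
subsets of the `n` variables. -/
abbrev Point (n : ℕ) : Type := {S : Finset (Fin n) // S.Nonempty} → ℝ

/-- The entropy profile of a tuple of random variables. -/
def RandomTuple.profile {n : ℕ} (𝒳 : RandomTuple n) : Point n :=
  fun S => 𝒳.entropy S.1

/-- The set of entropic points. -/
def entropicPoints (n : ℕ) : Set (Point n) := Set.range (RandomTuple.profile (n := n))

/-- The set of almost entropic points. -/
def almostEntropicPoints (n : ℕ) : Set (Point n) := closure (entropicPoints n)

/-- The coefficients `κ` define an (unconditional) linear information inequality. -/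
def IsLinearInformationInequality {n : ℕ} (κ : Point n) : Prop :=
  ∀ 𝒳 : RandomTuple n, 0 ≤ ∑ S, κ S * 𝒳.profile S

/-- The point `h` satisfies all unconditional linear information inequalities. -/
def SatisfiesAllLinearInequalities {n : ℕ} (h : Point n) : Prop :=
  ∀ κ : Point n, IsLinearInformationInequality κ → 0 ≤ ∑ S, κ S * h S

namespace Point

variable {n : ℕ}

/-- The coordinate `H(S)` of a point, with the convention `H(∅) = 0`. -/
def H (h : Point n) (S : Finset (Fin n)) : ℝ :=
  if hS : S.Nonempty then h ⟨S, hS⟩ else 0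

/-- `H(S | T)`. -/
def condH (h : Point n) (S T : Finset (Fin n)) : ℝ := h.H (S ∪ T) - h.H T

/-- `I(S : T | U)`. -/
def condI (h : Point n) (S T U : Finset (Fin n)) : ℝ :=
  h.H (S ∪ U) + h.H (T ∪ U) - h.H (S ∪ T ∪ U) - h.H U

/-- `I(S : T)`. -/
def I (h : Point n) (S T : Finset (Fin n)) : ℝ := h.H S + h.H T - h.H (S ∪ T)

/-- The box expression `I(C : D | A) + I(C : D | B) + I(A : B) - I(C : D)`. -/
def box (h : Point n) (A B C D : Finset (Fin n)) : ℝ :=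
  h.condI C D A + h.condI C D B + h.I A B - h.I C D

end Point

/-- The four variables `A, B, C, D` of a quadruple. -/
abbrev vA : Finset (Fin 4) := {0}
abbrev vB : Finset (Fin 4) := {1}
abbrev vC : Finset (Fin 4) := {2}
abbrev vD : Finset (Fin 4) := {3}

/-- The conditional inequality `(I1)` of Zhang and Yeung at the point `h`:
if `I(A : B | C) = I(A : B) = 0`, then the box expression is nonnegative. -/
def SatisfiesI1 (h : Point 4) : Prop :=
  h.condI vA vB vC = 0 ∧ h.I vA vB = 0 → 0 ≤ h.box vA vB vC vD

/-- The conditional inequality `(I3)` at the point `h`: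
if `I(A : B | C) = H(C | A, B) = 0`, then the box expression is nonnegative. -/
def SatisfiesI3 (h : Point 4) : Prop :=
  h.condI vA vB vC = 0 ∧ h.condH vC (vA ∪ vB) = 0 → 0 ≤ h.box vA vB vC vD

end InfoIneq

end

/-! At each of n indices take a random line over the field with 17 elements and two independent
random abscissas on it. A and B are the two points, C is the line, D is the parabola with leading
coefficient 1 meeting the line at those abscissas. Given C, the points are independent, so I(A:B|C)
= 0, while I(C:D|A) = I(C:D|B) = 0. But given C, D depends only on the unordered pair of abscissas,
so I(C:D) is at least log(289/153) bits per index (`quadruple_H_CD_le`). The only defect is that the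
abscissas coincide at about n/17 indices, where A and B are the same point; this makes I(A:B) and
H(C|A,B) positive.

A linear hash of 2n/17 symbols repairs this. Averaging (`exists_matrix_separates`) gives a matrix M
that is injective on vectors supported on the coincidence set, outside an event of exponentially
small probability. For (I1), the ordinates of A are kept only modulo the row space of M, which makes
A and B nearly independent (`ordinatesHom_surjective`). For (I3), M applied to the slopes is added
to A, so that A and B nearly always determine C (`le_hashedSlope_H_AB`). Up to an exponentially
small relative error, either change raises the box by at most the length of the hash, less than the
gain from I(C:D).

With n = 17(k+2), division by k+2 sends the defect to 0 and keeps the box below a negative constant.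
Dilution, that is, sampling with probability 1/(k+2) and otherwise emitting a constant, realises the
scaling up to a vanishing error, and compactness gives the limit point
(`exists_almostEntropic_limit`). Linear inequalities pass to the closure. -/

noncomputable section

open MeasureTheory Filter Topology

namespace InfoIneq

/-! ### Entropy on a finite uniform space, through fibre sizes -/

section FiberEntropy

open scoped Classical in
/-- The number of points at which `f` takes the same value as at `ω`. -/
def fiberCard {Ω β : Type*} [Fintype Ω] (f : Ω → β) (ω : Ω) : ℕ :=
  (Finset.univ.filter fun ω' => f ω' = f ω).card

/-- The entropy, in bits, of `f` seen as a random variable on the uniform space `Ω`. -/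
def fiberEntropy {Ω β : Type*} [Fintype Ω] (f : Ω → β) : ℝ :=
  (∑ ω, Real.logb 2 (Fintype.card Ω / fiberCard f ω)) / Fintype.card Ω

variable {Ω β γ : Type*} [Fintype Ω]

theorem fiberCard_pos (f : Ω → β) (ω : Ω) : 0 < fiberCard f ω := by
  classical
  exact Finset.card_pos.2 ⟨ω, by simp⟩

theorem fiberCard_le_card (f : Ω → β) (ω : Ω) : fiberCard f ω ≤ Fintype.card Ω :=
  Finset.card_le_univ _

theorem fiberCard_mono {f : Ω → β} {g : Ω → γ} (h : ∀ ω ω', g ω = g ω' → f ω = f ω') (ω : Ω) :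
    fiberCard g ω ≤ fiberCard f ω := by
  classical
  refine Finset.card_le_card fun ω' hω' => ?_
  simp only [Finset.mem_filter, Finset.mem_univ, true_and] at hω' ⊢
  exact h _ _ hω'

theorem logb_fiber_nonneg (f : Ω → β) (ω : Ω) :
    0 ≤ Real.logb 2 (Fintype.card Ω / fiberCard f ω) := by
  have h0 : (0 : ℝ) < fiberCard f ω := by exact_mod_cast fiberCard_pos f ω
  refine Real.logb_nonneg (by norm_num) ?_
  rw [le_div_iff₀ h0, one_mul]
  exact_mod_cast fiberCard_le_card f ω

theorem fiberEntropy_nonneg (f : Ω → β) : 0 ≤ fiberEntropy f :=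
  div_nonneg (Finset.sum_nonneg fun ω _ => logb_fiber_nonneg f ω) (Nat.cast_nonneg _)

theorem fiberEntropy_mono {f : Ω → β} {g : Ω → γ} (h : ∀ ω ω', g ω = g ω' → f ω = f ω') :
    fiberEntropy f ≤ fiberEntropy g := by
  unfold fiberEntropy
  gcongr with ω _
  · norm_num
  · have := fiberCard_pos f ω
    have : 0 < Fintype.card Ω := Fintype.card_pos_iff.2 ⟨ω⟩
    positivity
  · exact_mod_cast fiberCard_pos g ω
  · exact fiberCard_mono h ω

/-- Each nonempty fibre contributes exactly 1 to the sum. -/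
theorem sum_inv_fiberCard_le [Fintype γ] (g : Ω → γ) :
    ∑ ω, (1 / fiberCard g ω : ℝ) ≤ Fintype.card γ := by
  classical
  rw [← Finset.sum_fiberwise Finset.univ g]
  calc _ ≤ ∑ _x : γ, (1 : ℝ) := Finset.sum_le_sum fun x _ => ?_
    _ = _ := by simp
  by_cases hx : ∃ ω, g ω = x
  · obtain ⟨ω₀, rfl⟩ := hx
    have : ∀ ω ∈ Finset.univ.filter (fun ω => g ω = g ω₀),
        (1 / fiberCard g ω : ℝ) = 1 / fiberCard g ω₀ := by
      intro ω hω
      simp only [Finset.mem_filter, Finset.mem_univ, true_and] at hω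
      simp [fiberCard, hω]
    rw [Finset.sum_congr rfl this, Finset.sum_const, nsmul_eq_mul]
    have h0 : (0 : ℝ) < fiberCard g ω₀ := by exact_mod_cast fiberCard_pos g ω₀
    have : ((Finset.univ.filter (fun ω => g ω = g ω₀)).card : ℝ) = fiberCard g ω₀ := by
      simp [fiberCard]
    rw [this, mul_one_div_cancel h0.ne']
  · rw [Finset.filter_false_of_mem (fun ω _ h => hx ⟨ω, h⟩)]
    simp

/-- The inequality log t ≤ t - 1, applied pointwise to the ratio of the fibre's expected size to its
actual size; the error terms sum to at most 0. -/
theorem fiberEntropy_le_logb_card [Fintype γ] [Nonempty Ω] (g : Ω → γ) :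
    fiberEntropy g ≤ Real.logb 2 (Fintype.card γ) := by
  have hΩ : (0 : ℝ) < Fintype.card Ω := by exact_mod_cast Fintype.card_pos
  have : Nonempty γ := Nonempty.map g inferInstance
  have hγ : (0 : ℝ) < Fintype.card γ := by exact_mod_cast Fintype.card_pos
  have h2 : 0 < Real.log 2 := Real.log_pos (by norm_num)
  unfold fiberEntropy
  rw [div_le_iff₀ hΩ]
  have key : ∀ ω, Real.logb 2 (Fintype.card Ω / fiberCard g ω) ≤
      Real.logb 2 (Fintype.card γ) +
        (Fintype.card Ω / Fintype.card γ * (1 / fiberCard g ω) - 1) / Real.log 2 := by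
    intro ω
    have h0 : (0 : ℝ) < fiberCard g ω := by exact_mod_cast fiberCard_pos g ω
    rw [← sub_le_iff_le_add', ← Real.logb_div (by positivity) (by positivity), Real.logb]
    gcongr
    refine (Real.log_le_sub_one_of_pos (by positivity)).trans (le_of_eq ?_)
    field_simp
  refine (Finset.sum_le_sum fun ω _ => key ω).trans ?_
  rw [Finset.sum_add_distrib, ← Finset.sum_div, Finset.sum_sub_distrib, ← Finset.mul_sum]
  have h1 : (Fintype.card Ω / Fintype.card γ : ℝ) * ∑ ω, (1 / fiberCard g ω : ℝ) ≤
      Fintype.card Ω := by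
    calc _ ≤ (Fintype.card Ω / Fintype.card γ : ℝ) * Fintype.card γ := by
          gcongr; exact sum_inv_fiberCard_le g
      _ = _ := by field_simp
  simp only [Finset.sum_const, Finset.card_univ, nsmul_eq_mul, mul_one]
  have : ((Fintype.card Ω / Fintype.card γ : ℝ) * ∑ ω, (1 / fiberCard g ω : ℝ) -
      Fintype.card Ω) / Real.log 2 ≤ 0 := div_nonpos_of_nonpos_of_nonneg (by linarith) h2.le
  linarith

/-- Lets lower bounds survive an exceptional event: the terms outside `G` are nonnegative and are
dropped. -/
theorem le_fiberEntropy_of_fiberCard_le {f : Ω → β} (G : Finset Ω) {m : ℝ}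
    (h : ∀ ω ∈ G, (fiberCard f ω : ℝ) ≤ m) :
    G.card / Fintype.card Ω * Real.logb 2 (Fintype.card Ω / m) ≤ fiberEntropy f := by
  unfold fiberEntropy
  rw [div_mul_eq_mul_div]
  gcongr
  calc (G.card : ℝ) * Real.logb 2 (Fintype.card Ω / m)
      = ∑ _ω ∈ G, Real.logb 2 (Fintype.card Ω / m) := by simp
    _ ≤ ∑ ω ∈ G, Real.logb 2 (Fintype.card Ω / fiberCard f ω) := by
        refine Finset.sum_le_sum fun ω hω => ?_
        have h0 : (0 : ℝ) < fiberCard f ω := by exact_mod_cast fiberCard_pos f ω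
        have h1 : (0 : ℝ) < m := h0.trans_le (h ω hω)
        have : 0 < Fintype.card Ω := Fintype.card_pos_iff.2 ⟨ω⟩
        have h3 := h ω hω
        gcongr
        norm_num
    _ ≤ _ := Finset.sum_le_sum_of_subset_of_nonneg (Finset.subset_univ _)
        fun ω _ _ => logb_fiber_nonneg f ω

theorem fiberCard_le_of_injective [Fintype γ] {f : Ω → β} (k : Ω → γ)
    (h : ∀ ω ω', f ω = f ω' → k ω = k ω' → ω = ω') (ω : Ω) :
    fiberCard f ω ≤ Fintype.card γ := by
  classical
  refine Finset.card_le_card_of_injOn k (fun _ _ => Finset.mem_univ _) fun a ha b hb hab => ?_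
  simp only [Finset.coe_filter, Finset.mem_univ, true_and, Set.mem_ofPred_eq] at ha hb
  exact h _ _ (ha.trans hb.symm) hab

/-- Here `k` is the information that `f` lacks to recover the sample; it accounts for at most the
logarithm of its range. -/
theorem le_fiberEntropy_of_injective [Fintype γ] [Nonempty Ω] {f : Ω → β} (k : Ω → γ)
    (h : ∀ ω ω', f ω = f ω' → k ω = k ω' → ω = ω') :
    Real.logb 2 (Fintype.card Ω / Fintype.card γ) ≤ fiberEntropy f := by
  have := le_fiberEntropy_of_fiberCard_le (f := f) Finset.univ (m := Fintype.card γ)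
    fun ω _ => by exact_mod_cast fiberCard_le_of_injective k h ω
  have hΩ : (0 : ℝ) < Fintype.card Ω := by exact_mod_cast Fintype.card_pos
  rwa [Finset.card_univ, div_self hΩ.ne', one_mul] at this

/-- The entropy of the uniform variable restricted to an event of probability `1 / k`, padded
with an extra symbol outside of it. -/
theorem fiberEntropy_dilute [Nonempty Ω] (k : ℕ) {f : Ω → β} {g : Ω × Fin (k + 2) → γ}
    (h₀ : ∀ ω ω', g (ω, 0) = g (ω', 0) ↔ f ω = f ω')
    (h₁ : ∀ ω ω' j, j ≠ 0 → g (ω, j) ≠ g (ω', 0))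
    (h₂ : ∀ ω ω' i j, i ≠ 0 → j ≠ 0 → g (ω, i) = g (ω', j)) :
    fiberEntropy g = fiberEntropy f / ((k : ℝ) + 2) +
      (Real.logb 2 ((k : ℝ) + 2) + ((k : ℝ) + 1) *
        Real.logb 2 (((k : ℝ) + 2) / ((k : ℝ) + 1))) / ((k : ℝ) + 2) := by
  classical
  have hΩ : (0 : ℝ) < Fintype.card Ω := by exact_mod_cast Fintype.card_pos
  have c0 : ∀ ω, fiberCard g (ω, 0) = fiberCard f ω := by
    intro ω
    symm
    refine Finset.card_bij (fun ω' _ => (ω', 0)) ?_ ?_ ?_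
    · intro a ha
      simpa [h₀] using ha
    · intro a _ b _ hab
      simpa using hab
    · rintro ⟨a, j⟩ ha
      simp only [Finset.mem_filter, Finset.mem_univ, true_and] at ha
      by_cases hj : j = 0
      · subst hj
        exact ⟨a, by simpa [h₀] using ha, rfl⟩
      · exact absurd ha (h₁ _ _ _ hj)
  have c1 : ∀ ω (j : Fin (k + 1)), fiberCard g (ω, j.succ) = Fintype.card Ω * (k + 1) := by
    intro ω j
    have : (Finset.univ.filter fun p => g p = g (ω, j.succ)) =
        Finset.univ.map ⟨fun p : Ω × Fin (k + 1) => (p.1, p.2.succ), by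
          rintro ⟨a, b⟩ ⟨c, d⟩ h; simpa using h⟩ := by
      ext ⟨a, i⟩
      simp only [Finset.mem_filter, Finset.mem_univ, true_and, Finset.mem_map,
        Prod.exists]
      constructor
      · intro h
        have hi : i ≠ 0 := by
          rintro rfl
          exact h₁ _ _ _ (Fin.succ_ne_zero j) h.symm
        obtain ⟨i', rfl⟩ := Fin.exists_succ_eq.2 hi
        exact ⟨a, i', rfl⟩
      · rintro ⟨_, b, h⟩
        cases h
        exact h₂ _ _ _ _ (Fin.succ_ne_zero _) (Fin.succ_ne_zero _)
    rw [fiberCard, this, Finset.card_map, Finset.card_univ, Fintype.card_prod, Fintype.card_fin]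
  unfold fiberEntropy
  rw [Fintype.sum_prod_type]
  simp_rw [Fin.sum_univ_succ (n := k + 1), c0, c1]
  have e1 : ∀ ω, Real.logb 2 ((Fintype.card (Ω × Fin (k + 2)) : ℝ) / fiberCard f ω) =
      Real.logb 2 (Fintype.card Ω / fiberCard f ω) + Real.logb 2 ((k : ℝ) + 2) := by
    intro ω
    have h0 : (0 : ℝ) < fiberCard f ω := by exact_mod_cast fiberCard_pos f ω
    rw [← Real.logb_mul (by positivity) (by positivity), Fintype.card_prod, Fintype.card_fin]
    push_cast
    ring_nf
  have e2 : ((Fintype.card (Ω × Fin (k + 2)) : ℝ) / (Fintype.card Ω * (k + 1) : ℕ)) =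
      ((k : ℝ) + 2) / ((k : ℝ) + 1) := by
    rw [Fintype.card_prod, Fintype.card_fin]
    push_cast
    field_simp
  simp_rw [e1, e2]
  rw [Finset.sum_add_distrib, Finset.sum_add_distrib, Fintype.card_prod, Fintype.card_fin]
  simp only [Finset.sum_const, Finset.card_univ, Fintype.card_fin, nsmul_eq_mul]
  push_cast
  field_simp
  ring

end FiberEntropy

/-! ### Entropy profiles of functions on a uniform space -/

section Uniform

variable {n : ℕ}

/-- The uniform probability measure on a finite type, as a tuple of functions on it. -/
def uniformTuple {Ω β : Type} [Fintype Ω] [Nonempty Ω] [Fintype β] (X : Fin n → Ω → β) :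
    RandomTuple n :=
  letI : MeasurableSpace Ω := ⊤
  { Ω := Ω
    mΩ := ⊤
    μ := (PMF.uniformOfFintype Ω).toMeasure
    prob := inferInstance
    α := fun _ => β
    X := X
    measurable_fiber := fun _ _ => trivial }

/-- The entropy profile of a tuple of functions on a uniform finite space. -/
def uniformProfile {Ω β : Type} [Fintype Ω] (X : Fin n → Ω → β) : Point n :=
  fun S => fiberEntropy fun ω (i : S.1) => X i ω

theorem profile_uniformTuple {Ω β : Type} [Fintype Ω] [Nonempty Ω] [Fintype β]
    (X : Fin n → Ω → β) : (uniformTuple X).profile = uniformProfile X := by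
  classical
  funext S
  have hΩ : (0 : ℝ) < Fintype.card Ω := by exact_mod_cast Fintype.card_pos
  set f : Ω → (S.1 → β) := fun ω i => X i ω with hf
  have hprb : ∀ x : S.1 → β, (uniformTuple X).prb S.1 x =
      (Finset.univ.filter fun ω => f ω = x).card / Fintype.card Ω := by
    intro x
    let _ : MeasurableSpace Ω := ⊤
    change ((PMF.uniformOfFintype Ω).toMeasure (f ⁻¹' {x})).toReal = _
    rw [PMF.toMeasure_uniformOfFintype_apply _ MeasurableSpace.measurableSet_top]
    rw [ENNReal.toReal_div]
    simp only [ENNReal.toReal_natCast]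
    congr 2
    rw [Fintype.card_subtype]
    exact congrArg _ (by ext; simp)
  change ∑ x : S.1 → β, (uniformTuple X).prb S.1 x *
    Real.logb 2 (1 / (uniformTuple X).prb S.1 x) = fiberEntropy f
  simp_rw [hprb]
  unfold fiberEntropy
  rw [← Finset.sum_fiberwise Finset.univ f, Finset.sum_div]
  refine Finset.sum_congr rfl fun x _ => ?_
  have : ∀ ω ∈ Finset.univ.filter (fun ω => f ω = x),
      Real.logb 2 (Fintype.card Ω / fiberCard f ω) =
      Real.logb 2 (Fintype.card Ω / (Finset.univ.filter fun ω => f ω = x).card) := by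
    intro ω hω
    simp only [Finset.mem_filter, Finset.mem_univ, true_and] at hω
    simp [fiberCard, hω]
  rw [Finset.sum_congr rfl this, Finset.sum_const, nsmul_eq_mul, one_div_div]
  ring

theorem uniformProfile_mem_entropicPoints {Ω β : Type} [Fintype Ω] [Nonempty Ω] [Fintype β]
    (X : Fin n → Ω → β) : uniformProfile X ∈ entropicPoints n :=
  ⟨_, profile_uniformTuple X⟩

variable {Ω β γ : Type} [Fintype Ω] {X : Fin n → Ω → β}

theorem uniformProfile_H (X : Fin n → Ω → β) {S : Finset (Fin n)} (hS : S.Nonempty) :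
    (uniformProfile X).H S = fiberEntropy fun ω (i : S) => X i ω := by
  simp [Point.H, hS, uniformProfile]

theorem uniformProfile_H_le [Nonempty Ω] [Fintype γ] {S : Finset (Fin n)} (hS : S.Nonempty)
    (g : Ω → γ) (h : ∀ ω ω', g ω = g ω' → ∀ i ∈ S, X i ω = X i ω') :
    (uniformProfile X).H S ≤ Real.logb 2 (Fintype.card γ) := by
  rw [uniformProfile_H X hS]
  refine (fiberEntropy_mono (g := g) fun ω ω' hω => ?_).trans (fiberEntropy_le_logb_card g)
  funext i
  exact h _ _ hω _ i.2

theorem le_uniformProfile_H [Nonempty Ω] [Fintype γ] {S : Finset (Fin n)} (hS : S.Nonempty)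
    (k : Ω → γ) (h : ∀ ω ω', (∀ i ∈ S, X i ω = X i ω') → k ω = k ω' → ω = ω') :
    Real.logb 2 (Fintype.card Ω / Fintype.card γ) ≤ (uniformProfile X).H S := by
  rw [uniformProfile_H X hS]
  refine le_fiberEntropy_of_injective k fun ω ω' hω => h ω ω' fun i hi => ?_
  exact congrFun hω ⟨i, hi⟩

/-- The symbol `none` is emitted by all variables at once, so every nonempty sub-tuple pays the same
additive cost. -/
theorem exists_dilution {Ω β : Type} [Fintype Ω] [Nonempty Ω] [Fintype β] (X : Fin n → Ω → β)
    (k : ℕ) : (fun S => uniformProfile X S / ((k : ℝ) + 2) +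
      (Real.logb 2 ((k : ℝ) + 2) + ((k : ℝ) + 1) *
        Real.logb 2 (((k : ℝ) + 2) / ((k : ℝ) + 1))) / ((k : ℝ) + 2)) ∈ entropicPoints n := by
  have := uniformProfile_mem_entropicPoints
    (fun i (p : Ω × Fin (k + 2)) => if p.2 = 0 then some (X i p.1) else none)
  convert this using 1
  funext S
  obtain ⟨i, hi⟩ := S.2
  refine (fiberEntropy_dilute k ?_ ?_ ?_).symm
  · intro ω ω'
    simp [funext_iff]
  · intro ω ω' j hj h
    simpa [hj] using congrFun h ⟨i, hi⟩
  · intro ω ω' i j hi hj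
    simp [hi, hj]

end Uniform

/-! ### Scaling by dilution and passage to the limit -/

section Limit

/-- The cost is the binary entropy of 1/(k+2). Its second term stays bounded before division,
because log(1 + 1/(k+1)) ≤ 1/(k+1). -/
theorem tendsto_dilution_cost :
    Tendsto (fun k : ℕ => (Real.logb 2 ((k : ℝ) + 2) + ((k : ℝ) + 1) *
        Real.logb 2 (((k : ℝ) + 2) / ((k : ℝ) + 1))) / ((k : ℝ) + 2)) atTop (𝓝 0) := by
  have h2 : 0 < Real.log 2 := Real.log_pos (by norm_num)
  have hcast : Tendsto (fun k : ℕ => (k : ℝ) + 2) atTop atTop :=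
    tendsto_atTop_add_const_right _ _ tendsto_natCast_atTop_atTop
  have hlog : Tendsto (fun x : ℝ => Real.log x / x) atTop (𝓝 0) := by
    simpa using Real.tendsto_pow_log_div_mul_add_atTop 1 0 1 one_ne_zero
  have hlim : Tendsto (fun k : ℕ => (Real.log ((k : ℝ) + 2) / ((k : ℝ) + 2) +
      1 / ((k : ℝ) + 2)) / Real.log 2) atTop (𝓝 0) := by
    have := ((hlog.comp hcast).add (tendsto_inv_atTop_zero.comp hcast)).div_const (Real.log 2)
    simpa [Function.comp_def] using this
  refine squeeze_zero (fun k => ?_) (fun k => ?_) hlim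
  · have h1 : 0 ≤ Real.logb 2 ((k : ℝ) + 2) := Real.logb_nonneg (by norm_num) (by linarith [
      (Nat.cast_nonneg k : (0 : ℝ) ≤ k)])
    have h3 : 0 ≤ Real.logb 2 (((k : ℝ) + 2) / ((k : ℝ) + 1)) := by
      refine Real.logb_nonneg (by norm_num) ?_
      rw [le_div_iff₀ (by positivity)]
      linarith
    positivity
  · have h4 : ((k : ℝ) + 1) * Real.log (((k : ℝ) + 2) / ((k : ℝ) + 1)) ≤ 1 := by
      have h5 : Real.log (((k : ℝ) + 2) / ((k : ℝ) + 1)) ≤ _ :=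
        Real.log_le_sub_one_of_pos (by positivity)
      calc _ ≤ ((k : ℝ) + 1) * (((k : ℝ) + 2) / ((k : ℝ) + 1) - 1) := by gcongr
        _ = 1 := by field_simp; ring
    rw [Real.logb, Real.logb, ← add_div, ← mul_div_assoc, ← add_div, div_div, mul_comm (Real.log 2),
      ← div_div]
    gcongr

/-- Entropy profiles of uniform tuples that grow at most linearly have, after scaling, an almost
entropic limit point. -/
theorem exists_almostEntropic_limit {n : ℕ} (e : ℕ → Point n) (b : ℝ)
    (he : ∀ k, ∃ (Ω β : Type) (_ : Fintype Ω) (_ : Nonempty Ω) (_ : Fintype β)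
      (X : Fin n → Ω → β), e k = uniformProfile X)
    (hb : ∀ k S, e k S ≤ b * ((k : ℝ) + 2)) :
    ∃ h ∈ almostEntropicPoints n, ∃ φ : ℕ → ℕ, StrictMono φ ∧
      ∀ S, Tendsto (fun j => e (φ j) S / ((φ j : ℝ) + 2)) atTop (𝓝 (h S)) := by
  have hmem : ∀ k, (fun S => e k S / ((k : ℝ) + 2)) ∈
      Set.Icc (0 : Point n) (fun _ => b) := by
    intro k
    refine ⟨fun S => ?_, fun S => ?_⟩
    · obtain ⟨Ω, β, _, _, _, X, hX⟩ := he k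
      change (0 : ℝ) ≤ e k S / _
      rw [hX]
      exact div_nonneg (fiberEntropy_nonneg _) (by positivity)
    · change e k S / _ ≤ b
      rw [div_le_iff₀ (by positivity)]
      exact hb k S
  obtain ⟨h, -, φ, hφ, hlim⟩ := isCompact_Icc.tendsto_subseq hmem
  have hS : ∀ S, Tendsto (fun j => e (φ j) S / ((φ j : ℝ) + 2)) atTop (𝓝 (h S)) :=
    tendsto_pi_nhds.1 hlim
  refine ⟨h, ?_, φ, hφ, hS⟩
  refine mem_closure_of_tendsto (f := fun j S => e (φ j) S / ((φ j : ℝ) + 2) +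
      (Real.logb 2 ((φ j : ℝ) + 2) + ((φ j : ℝ) + 1) *
        Real.logb 2 (((φ j : ℝ) + 2) / ((φ j : ℝ) + 1))) / ((φ j : ℝ) + 2)) (b := atTop) ?_
    (Eventually.of_forall fun j => ?_)
  · refine tendsto_pi_nhds.2 fun S => ?_
    simpa using (hS S).add (tendsto_dilution_cost.comp hφ.tendsto_atTop)
  · obtain ⟨Ω, β, _, _, _, X, hX⟩ := he (φ j)
    simp only [hX]
    exact exists_dilution X (φ j)

theorem satisfiesAllLinearInequalities_of_mem {n : ℕ} {h : Point n}
    (hh : h ∈ almostEntropicPoints n) : SatisfiesAllLinearInequalities h := by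
  intro κ hκ
  have hclosed : IsClosed {h : Point n | 0 ≤ ∑ S, κ S * h S} :=
    isClosed_le continuous_const (by fun_prop)
  refine closure_minimal ?_ hclosed hh
  rintro _ ⟨𝒳, rfl⟩
  exact hκ 𝒳

end Limit

/-! ### Random matrices injective on most coincidence sets -/

section RandomMatrix

open Finset Matrix

open scoped Classical in
theorem card_fiber_mul_card {G H : Type*} [AddGroup G] [AddGroup H] [Fintype G] [Fintype H]
    (f : G →+ H) (hf : Function.Surjective f) (y : H) :
    (univ.filter fun g => f g = y).card * Fintype.card H = Fintype.card G := by
  rw [← card_univ (α := G),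
    card_eq_sum_card_fiberwise (s := (univ : Finset G)) (f := f) (t := univ) (by simp)]
  rw [sum_congr rfl fun z _ => AddMonoidHom.card_fiber_eq_of_mem_range f (hf z) (hf y)]
  simp [mul_comm]

section Agreement

variable {F ι : Type} [Fintype F] [DecidableEq F] [Fintype ι] [DecidableEq ι]

/-- The coordinates at which two vectors agree. -/
def agreement (x : (ι → F) × (ι → F)) : Finset ι := univ.filter fun i => x.1 i = x.2 i

/-- The summand is a product over the coordinates, so the sum factors; with q = |F|, each factor is
2q + q(q - 1). -/
theorem sum_two_pow_card_agreement :
    ∑ x : (ι → F) × (ι → F), 2 ^ (agreement x).card =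
      (Fintype.card F ^ 2 + Fintype.card F) ^ Fintype.card ι := by
  have h1 : ∑ p : F × F, (if p.1 = p.2 then 2 else 1 : ℕ) =
      Fintype.card F ^ 2 + Fintype.card F := by
    have : ∀ a b : F, (if a = b then 2 else 1 : ℕ) = 1 + if a = b then 1 else 0 := by
      intro a b; split_ifs <;> rfl
    rw [Fintype.sum_prod_type]
    simp [this, sum_add_distrib, sq, mul_add]
  rw [← h1, ← card_univ (α := ι), ← prod_const, prod_univ_sum, Fintype.piFinset_univ,
    ← (Equiv.arrowProdEquivProdArrow ι (fun _ => F) (fun _ => F)).sum_comp]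
  refine sum_congr rfl fun x _ => ?_
  rw [agreement, prod_ite]
  simp only [prod_const, one_pow, mul_one]
  congr 2

end Agreement

variable {F ι : Type} [Field F] [Fintype ι] [DecidableEq ι] {r : ℕ}

/-- The matrix `M` acts injectively on the vectors supported on `K`. -/
def Separates (M : Matrix (Fin r) ι F) (K : Finset ι) : Prop :=
  ∀ v : ι → F, (∀ i ∉ K, v i = 0) → M *ᵥ v = 0 → v = 0

/-- The columns of `M` indexed by `K` are independent, so that submatrix has a left inverse;
multiplying by it on the left prescribes the values on `K`. -/
theorem Separates.exists_vecMul_eq {M : Matrix (Fin r) ι F} {K : Finset ι} (h : Separates M K)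
    (t : ι → F) : ∃ w : Fin r → F, ∀ i ∈ K, (w ᵥ* M) i = t i := by
  set MK : Matrix (Fin r) K F := M.submatrix id (fun i : K => (i : ι)) with hMK
  have hker : LinearMap.ker MK.mulVecLin = ⊥ := by
    rw [LinearMap.ker_eq_bot']
    intro w hw
    have key : M *ᵥ (fun i => if hi : i ∈ K then w ⟨i, hi⟩ else 0) = 0 := by
      rw [← hw]
      funext j
      simp only [Matrix.mulVecLin_apply, Matrix.mulVec, dotProduct, hMK, submatrix_apply, id]
      rw [← sum_subset (subset_univ K) (fun i _ hi => by simp [hi]), ← sum_attach K]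
      simp [Finset.univ_eq_attach]
    have := h _ (fun i hi => by simp [hi]) key
    funext i
    simpa using congrFun this i
  obtain ⟨g, hg⟩ := MK.mulVecLin.exists_leftInverse_of_injective hker
  have hL : LinearMap.toMatrix' g * MK = 1 := by
    have : LinearMap.toMatrix' (g ∘ₗ MK.mulVecLin) = 1 := by rw [hg]; simp
    rwa [LinearMap.toMatrix'_comp, ← Matrix.toLin'_apply', LinearMap.toMatrix'_toLin'] at this
  refine ⟨(fun i : K => t i) ᵥ* LinearMap.toMatrix' g, fun i hi => ?_⟩
  have : (((fun i : K => t i) ᵥ* LinearMap.toMatrix' g) ᵥ* MK) ⟨i, hi⟩ = t i := by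
    rw [Matrix.vecMul_vecMul, hL, Matrix.vecMul_one]
  simpa [Matrix.vecMul, dotProduct, hMK] using this

variable [Fintype F] [DecidableEq F]

open scoped Classical in
theorem card_mulVec_eq_zero {v : ι → F} (hv : v ≠ 0) :
    (univ.filter fun M : Matrix (Fin r) ι F => M *ᵥ v = 0).card * Fintype.card F ^ r =
      Fintype.card (Matrix (Fin r) ι F) := by
  obtain ⟨i, hi⟩ := Function.ne_iff.1 hv
  have hi' : v i ≠ 0 := hi
  let f : Matrix (Fin r) ι F →+ (Fin r → F) :=
    { toFun := fun M => M *ᵥ v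
      map_zero' := Matrix.zero_mulVec v
      map_add' := fun A B => Matrix.add_mulVec A B v }
  have hf : Function.Surjective f := by
    intro y
    refine ⟨Matrix.of fun j i' => if i' = i then y j / v i else 0, ?_⟩
    funext j
    simp [f, Matrix.mulVec, dotProduct, hi']
  have := card_fiber_mul_card f hf 0
  rw [Fintype.card_fun, Fintype.card_fin] at this
  convert this
  rfl

-- Union bound over the nonzero vectors supported on `K`: each is killed with probability |F|^(-r).
-- The resulting |F|^(|K| - r) is weakened to base 2, since an average of 2^|K| over random
-- coincidence sets stays small whereas one of |F|^|K| would not.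
open scoped Classical in
theorem card_not_separates (K : Finset ι) :
    (univ.filter fun M : Matrix (Fin r) ι F => ¬ Separates M K).card * 2 ^ r ≤
      Fintype.card (Matrix (Fin r) ι F) * 2 ^ K.card := by
  rcases le_total r K.card with hr | hr
  · exact Nat.mul_le_mul (card_le_univ _) (Nat.pow_le_pow_right (by norm_num) hr)
  obtain ⟨s, rfl⟩ := Nat.exists_eq_add_of_le hr
  have hq : 2 ≤ Fintype.card F := Fintype.one_lt_card
  let ext : (K → F) → ι → F := fun w i => if hi : i ∈ K then w ⟨i, hi⟩ else 0
  have hsub : (univ.filter fun M : Matrix (Fin (K.card + s)) ι F => ¬ Separates M K) ⊆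
      (univ.filter fun w : K → F => ext w ≠ 0).biUnion
        fun w => univ.filter fun M => M *ᵥ ext w = 0 := by
    intro M hM
    simp only [mem_filter, mem_univ, true_and, Separates, not_forall, mem_biUnion] at hM ⊢
    obtain ⟨v, hv, hMv, hv0⟩ := hM
    have : ext (fun i => v i) = v := by
      funext i
      by_cases hi : i ∈ K <;> simp [ext, hi, hv]
    exact ⟨fun i => v i, by rwa [this], by rwa [this]⟩
  have h1 : (univ.filter fun M : Matrix (Fin (K.card + s)) ι F => ¬ Separates M K).card *
      Fintype.card F ^ (K.card + s) ≤
      Fintype.card F ^ K.card * Fintype.card (Matrix (Fin (K.card + s)) ι F) := by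
    refine (Nat.mul_le_mul_right _ ((card_le_card hsub).trans card_biUnion_le)).trans ?_
    rw [sum_mul, sum_congr rfl fun w hw => card_mulVec_eq_zero (mem_filter.1 hw).2, sum_const,
      smul_eq_mul]
    refine Nat.mul_le_mul_right _ ((card_le_univ _).trans ?_)
    simp
  rw [pow_add, mul_left_comm] at h1
  have h2 := Nat.le_of_mul_le_mul_left h1 (by positivity)
  rw [pow_add, mul_left_comm, mul_comm (Fintype.card (Matrix _ _ _))]
  refine Nat.mul_le_mul_left _ (le_trans ?_ h2)
  gcongr

-- Some matrix does at least as well as the average over all matrices.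
open scoped Classical in
theorem exists_matrix_separates (F ι : Type) [Field F] [Fintype F] [DecidableEq F] [Fintype ι]
    [DecidableEq ι] (r : ℕ) : ∃ M : Matrix (Fin r) ι F,
      (univ.filter fun x : (ι → F) × (ι → F) => ¬ Separates M (agreement x)).card * 2 ^ r ≤
        (Fintype.card F ^ 2 + Fintype.card F) ^ Fintype.card ι := by
  have key : ∑ M : Matrix (Fin r) ι F,
      (univ.filter fun x : (ι → F) × (ι → F) => ¬ Separates M (agreement x)).card * 2 ^ r ≤
      ∑ _M : Matrix (Fin r) ι F, (Fintype.card F ^ 2 + Fintype.card F) ^ Fintype.card ι := by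
    calc _ = ∑ x : (ι → F) × (ι → F), (univ.filter fun M : Matrix (Fin r) ι F =>
            ¬ Separates M (agreement x)).card * 2 ^ r := by
          rw [← sum_mul, ← sum_mul]
          congr 1
          simp only [card_filter]
          exact sum_comm
      _ ≤ ∑ x : (ι → F) × (ι → F), Fintype.card (Matrix (Fin r) ι F) *
            2 ^ (agreement x).card := sum_le_sum fun x _ => card_not_separates _
      _ = _ := by rw [← mul_sum, sum_two_pow_card_agreement, sum_const, card_univ, smul_eq_mul]
  obtain ⟨M, -, hM⟩ := exists_le_of_sum_le ⟨0, mem_univ _⟩ key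
  exact ⟨M, hM⟩

end RandomMatrix

theorem card_vector_pos (F ι : Type) [Fintype F] [Nonempty F] [Fintype ι] [DecidableEq ι] :
    (0 : ℝ) < Fintype.card (ι → F) := by
  exact_mod_cast Fintype.card_pos

/-! ### Lines, parabolas and the entropies that do not depend on the choice of hash -/

section LinesAndParabolas

set_option linter.unusedSectionVars false

open Finset Matrix

variable {F ι : Type} [Field F] [Fintype F] [DecidableEq F] [Fintype ι] [DecidableEq ι] {r : ℕ}

variable (F ι) in
/-- The sample space: coefficients `(c₀, c₁)` of lines `y = c₀ + c₁ x`, one for each `i : ι`, and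
the abscissas of two points on each of them. -/
abbrev Config : Type := ((ι → F) × (ι → F)) × ((ι → F) × (ι → F))

/-- Two points `A` and `B` on a line `C` and a parabola `D` meeting the line there, for every
index; of `A` we keep the abscissa and a hash `s` of the ordinate, and add a hash `w` of the
slope. -/
def quadruple (s : (ι → F) → (ι → F)) (w : (ι → F) → (Fin r → F)) :
    Fin 4 → Config F ι → (ι → F) × (ι → F) × (Fin r → F) :=
  ![fun ω => (ω.2.1, s (ω.1.1 + ω.1.2 * ω.2.1), w ω.1.2),
    fun ω => (ω.2.2, ω.1.1 + ω.1.2 * ω.2.2, 0),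
    fun ω => (ω.1.1, ω.1.2, 0),
    fun ω => (ω.1.1 + ω.2.1 * ω.2.2, ω.1.2 - (ω.2.1 + ω.2.2), 0)]

variable (F ι) in
/-- The number of bits in a vector of `ι → F`. -/
def vectorBits : ℝ := Real.logb 2 (Fintype.card (ι → F))

section Entropies

variable (s : (ι → F) → (ι → F)) (w : (ι → F) → (Fin r → F))

theorem quadruple_H_le (S : Finset (Fin 4)) (hS : S.Nonempty) :
    (uniformProfile (quadruple s w)).H S ≤ 4 * vectorBits F ι := by
  refine (uniformProfile_H_le hS id ?_).trans (le_of_eq ?_)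
  · rintro ω ω' h i -
    rw [id, id] at h
    rw [h]
  · have := card_vector_pos F ι
    simp only [Fintype.card_prod, Nat.cast_mul, vectorBits]
    rw [Real.logb_mul (by positivity) (by positivity), Real.logb_mul (by positivity) (by positivity)]
    ring

theorem quadruple_H_le_two {S : Finset (Fin 4)} (hS : S.Nonempty)
    (g : Config F ι → (ι → F) × (ι → F))
    (h : ∀ ω ω', g ω = g ω' → ∀ i ∈ S, quadruple s w i ω = quadruple s w i ω') :
    (uniformProfile (quadruple s w)).H S ≤ 2 * vectorBits F ι := by
  refine (uniformProfile_H_le hS g h).trans (le_of_eq ?_)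
  have := card_vector_pos F ι
  simp only [Fintype.card_prod, Nat.cast_mul, vectorBits]
  rw [Real.logb_mul (by positivity) (by positivity)]
  ring

theorem quadruple_H_le_three {S : Finset (Fin 4)} (hS : S.Nonempty)
    (g : Config F ι → (ι → F) × (ι → F) × (ι → F))
    (h : ∀ ω ω', g ω = g ω' → ∀ i ∈ S, quadruple s w i ω = quadruple s w i ω') :
    (uniformProfile (quadruple s w)).H S ≤ 3 * vectorBits F ι := by
  refine (uniformProfile_H_le hS g h).trans (le_of_eq ?_)
  have := card_vector_pos F ι
  simp only [Fintype.card_prod, Nat.cast_mul, vectorBits]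
  rw [Real.logb_mul (by positivity) (by positivity), Real.logb_mul (by positivity) (by positivity)]
  ring

theorem le_quadruple_H_two {S : Finset (Fin 4)} (hS : S.Nonempty)
    (k : Config F ι → (ι → F) × (ι → F))
    (h : ∀ ω ω', (∀ i ∈ S, quadruple s w i ω = quadruple s w i ω') → k ω = k ω' → ω = ω') :
    2 * vectorBits F ι ≤ (uniformProfile (quadruple s w)).H S := by
  refine (le_of_eq ?_).trans (le_uniformProfile_H hS k h)
  have := card_vector_pos F ι
  simp only [Fintype.card_prod, Nat.cast_mul, vectorBits]
  rw [mul_div_assoc, div_self (by positivity), mul_one,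
    Real.logb_mul (by positivity) (by positivity)]
  ring

theorem le_quadruple_H_three {S : Finset (Fin 4)} (hS : S.Nonempty)
    (k : Config F ι → (ι → F))
    (h : ∀ ω ω', (∀ i ∈ S, quadruple s w i ω = quadruple s w i ω') → k ω = k ω' → ω = ω') :
    3 * vectorBits F ι ≤ (uniformProfile (quadruple s w)).H S := by
  refine (le_of_eq ?_).trans (le_uniformProfile_H hS k h)
  have := card_vector_pos F ι
  simp only [Fintype.card_prod, Nat.cast_mul, vectorBits]
  rw [mul_div_assoc, mul_div_assoc, div_self (by positivity), mul_one,
    Real.logb_mul (by positivity) (by positivity), Real.logb_mul (by positivity) (by positivity)]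
  ring

theorem le_quadruple_H_four {S : Finset (Fin 4)} (hS : S.Nonempty)
    (h : ∀ ω ω', (∀ i ∈ S, quadruple s w i ω = quadruple s w i ω') → ω = ω') :
    4 * vectorBits F ι ≤ (uniformProfile (quadruple s w)).H S := by
  refine (le_of_eq ?_).trans
    (le_uniformProfile_H hS (fun _ => ()) fun ω ω' h₁ _ => h ω ω' h₁)
  have := card_vector_pos F ι
  simp only [Fintype.card_prod, Fintype.card_unit, Nat.cast_mul, vectorBits, Nat.cast_one, div_one]
  rw [Real.logb_mul (by positivity) (by positivity), Real.logb_mul (by positivity) (by positivity)]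
  ring

theorem quadruple_H_C : (uniformProfile (quadruple s w)).H vC = 2 * vectorBits F ι := by
  refine le_antisymm (quadruple_H_le_two s w (by simp) (fun ω => ω.1) ?_)
    (le_quadruple_H_two s w (by simp) (fun ω => ω.2) ?_)
  · rintro ⟨⟨c, d⟩, x, y⟩ ⟨⟨c', d'⟩, x', y'⟩ h
    simp_all [quadruple]
  · rintro ⟨⟨c, d⟩, x, y⟩ ⟨⟨c', d'⟩, x', y'⟩ h h'
    simp_all [quadruple]

theorem quadruple_H_B : (uniformProfile (quadruple s w)).H vB = 2 * vectorBits F ι := by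
  refine le_antisymm
    (quadruple_H_le_two s w (by simp) (fun ω => (ω.2.2, ω.1.1 + ω.1.2 * ω.2.2)) ?_)
    (le_quadruple_H_two s w (by simp) (fun ω => (ω.1.2, ω.2.1)) ?_)
  · rintro ⟨⟨c, d⟩, x, y⟩ ⟨⟨c', d'⟩, x', y'⟩ h
    simpa [quadruple] using h
  · rintro ⟨⟨c, d⟩, x, y⟩ ⟨⟨c', d'⟩, x', y'⟩ h h'
    simp [quadruple] at h h'
    obtain ⟨rfl, h⟩ := h
    obtain ⟨rfl, rfl⟩ := h'
    simpa using h

/-- Whatever the hashes, given the line, `A` carries exactly its abscissa. -/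
theorem quadruple_H_AC : (uniformProfile (quadruple s w)).H (vA ∪ vC) = 3 * vectorBits F ι := by
  refine le_antisymm
    (quadruple_H_le_three s w (by simp) (fun ω => (ω.1.1, ω.1.2, ω.2.1)) ?_)
    (le_quadruple_H_three s w (by simp) (fun ω => ω.2.2) ?_)
  · rintro ⟨⟨c, d⟩, x, y⟩ ⟨⟨c', d'⟩, x', y'⟩ h
    simp_all [quadruple]
  · rintro ⟨⟨c, d⟩, x, y⟩ ⟨⟨c', d'⟩, x', y'⟩ h h'
    simp_all [quadruple]

theorem quadruple_H_BC : (uniformProfile (quadruple s w)).H (vB ∪ vC) = 3 * vectorBits F ι := by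
  refine le_antisymm
    (quadruple_H_le_three s w (by simp) (fun ω => (ω.1.1, ω.1.2, ω.2.2)) ?_)
    (le_quadruple_H_three s w (by simp) (fun ω => ω.2.1) ?_)
  · rintro ⟨⟨c, d⟩, x, y⟩ ⟨⟨c', d'⟩, x', y'⟩ h
    simp_all [quadruple]
  · rintro ⟨⟨c, d⟩, x, y⟩ ⟨⟨c', d'⟩, x', y'⟩ h h'
    simp_all [quadruple]

theorem quadruple_H_ABC :
    (uniformProfile (quadruple s w)).H (vA ∪ vB ∪ vC) = 4 * vectorBits F ι := by
  refine le_antisymm (quadruple_H_le s w _ (by simp)) (le_quadruple_H_four s w (by simp) ?_)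
  rintro ⟨⟨c, d⟩, x, y⟩ ⟨⟨c', d'⟩, x', y'⟩ h
  simp_all [quadruple]

/-- The linear coefficient of the parabola, together with the slope and one abscissa, reveals the
other abscissa. -/
theorem quadruple_H_CDA :
    (uniformProfile (quadruple s w)).H (vC ∪ vD ∪ vA) = 4 * vectorBits F ι := by
  refine le_antisymm (quadruple_H_le s w _ (by simp)) (le_quadruple_H_four s w (by simp) ?_)
  rintro ⟨⟨c, d⟩, x, y⟩ ⟨⟨c', d'⟩, x', y'⟩ h
  simp [quadruple] at h
  obtain ⟨⟨rfl, rfl⟩, ⟨-, h2⟩, rfl, -⟩ := h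
  simpa using h2

theorem quadruple_H_CDB :
    (uniformProfile (quadruple s w)).H (vC ∪ vD ∪ vB) = 4 * vectorBits F ι := by
  refine le_antisymm (quadruple_H_le s w _ (by simp)) (le_quadruple_H_four s w (by simp) ?_)
  rintro ⟨⟨c, d⟩, x, y⟩ ⟨⟨c', d'⟩, x', y'⟩ h
  simp [quadruple] at h
  obtain ⟨⟨rfl, rfl⟩, ⟨-, h2⟩, rfl, -⟩ := h
  simpa using h2

theorem le_quadruple_H_D : 2 * vectorBits F ι ≤ (uniformProfile (quadruple s w)).H vD := by
  refine le_quadruple_H_two s w (by simp) (fun ω => ω.2) ?_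
  rintro ⟨⟨c, d⟩, x, y⟩ ⟨⟨c', d'⟩, x', y'⟩ h h'
  simp [quadruple] at h h'
  obtain ⟨rfl, rfl⟩ := h'
  simpa using h

/-- The ordinate of a point of the parabola, from its abscissa. -/
theorem ordinate_eq {R : Type*} [CommRing R] (c d x y : R) :
    c + d * x = (c + x * y) + (d - (x + y)) * x + x * x := by ring

theorem quadruple_H_DB_le :
    (uniformProfile (quadruple s w)).H (vD ∪ vB) ≤ 3 * vectorBits F ι := by
  refine quadruple_H_le_three s w (by simp)
    (fun ω => (ω.1.1 + ω.2.1 * ω.2.2, ω.1.2 - (ω.2.1 + ω.2.2), ω.2.2)) ?_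
  rintro ⟨⟨c, d⟩, x, y⟩ ⟨⟨c', d'⟩, x', y'⟩ h
  simp only [Prod.mk.injEq] at h
  obtain ⟨h1, h2, rfl⟩ := h
  have h3 : c + d * y = c' + d' * y := by
    rw [ordinate_eq c d y x, ordinate_eq c' d' y x', mul_comm y x, mul_comm y x', h1, add_comm y x,
      add_comm y x', h2]
  simp [quadruple, h1, h2, h3]

/-- The parabola involves the abscissas only through their sum and product, which are symmetric.
Forgetting their order saves nearly one bit per index; this is what makes the box negative. -/
theorem quadruple_H_CD_le : (uniformProfile (quadruple s w)).H (vC ∪ vD) ≤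
    2 * vectorBits F ι + Fintype.card ι * Real.logb 2 (Fintype.card (Sym2 F)) := by
  refine (uniformProfile_H_le (γ := ((ι → F) × (ι → F)) × (ι → Sym2 F)) (by simp)
    (fun ω => (ω.1, fun i => s(ω.2.1 i, ω.2.2 i))) ?_).trans (le_of_eq ?_)
  · rintro ⟨⟨c, d⟩, x, y⟩ ⟨⟨c', d'⟩, x', y'⟩ h
    simp only [Prod.mk.injEq] at h
    obtain ⟨⟨rfl, rfl⟩, h⟩ := h
    have h1 : x * y = x' * y' := by
      funext i
      rcases Sym2.eq_iff.1 (congrFun h i) with ⟨h1, h2⟩ | ⟨h1, h2⟩ <;>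
        simp only [Pi.mul_apply, h1, h2]
      exact mul_comm _ _
    have h2 : x + y = x' + y' := by
      funext i
      rcases Sym2.eq_iff.1 (congrFun h i) with ⟨h1, h2⟩ | ⟨h1, h2⟩ <;>
        simp only [Pi.add_apply, h1, h2]
      exact add_comm _ _
    simp [quadruple, h1, h2]
  · have := card_vector_pos F ι
    have h2 : (0 : ℝ) < Fintype.card (Sym2 F) := by
      have : Nonempty (Sym2 F) := ⟨s(0, 0)⟩
      exact_mod_cast Fintype.card_pos
    simp only [Fintype.card_prod, Nat.cast_mul, vectorBits]
    rw [Real.logb_mul (by positivity) (by rw [Fintype.card_fun]; push_cast; positivity),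
      Real.logb_mul (by positivity) (by positivity), Fintype.card_fun (α := ι) (β := Sym2 F),
      Nat.cast_pow, Real.logb_pow]
    ring

theorem quadruple_condI_eq_zero : (uniformProfile (quadruple s w)).condI vA vB vC = 0 := by
  rw [Point.condI, quadruple_H_AC, quadruple_H_BC, quadruple_H_ABC, quadruple_H_C]
  ring

/-- H(A) and H(B) cancel between the conditional informations and I(A:B), so the hash enters only
through H(A,D) and H(A,B). -/
theorem quadruple_box_le : (uniformProfile (quadruple s w)).box vA vB vC vD ≤
    (uniformProfile (quadruple s w)).H (vD ∪ vA) - (uniformProfile (quadruple s w)).H (vA ∪ vB) +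
      Fintype.card ι * Real.logb 2 (Fintype.card (Sym2 F)) - vectorBits F ι := by
  have h1 := quadruple_H_AC s w
  have h2 := quadruple_H_BC s w
  rw [Finset.union_comm] at h1 h2
  have h3 := le_quadruple_H_D s w
  have h4 := quadruple_H_CD_le s w
  have h5 := quadruple_H_DB_le s w
  rw [Point.box, Point.condI, Point.condI, Point.I, Point.I, h1, h2, quadruple_H_CDA,
    quadruple_H_CDB, quadruple_H_B, quadruple_H_C]
  linarith

open scoped Classical in
/-- The proportion of pairs of vectors whose agreement set is not separated by `M`. -/
def failureRate (M : Matrix (Fin r) ι F) : ℝ :=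
  (univ.filter fun x : (ι → F) × (ι → F) => ¬ Separates M (agreement x)).card /
    (Fintype.card (ι → F) : ℝ) ^ 2

theorem failureRate_nonneg (M : Matrix (Fin r) ι F) : 0 ≤ failureRate M := by
  unfold failureRate
  positivity

open scoped Classical in
theorem le_quadruple_H_AB {M : Matrix (Fin r) ι F} {m : ℝ} (hm : 1 ≤ m)
    (h : ∀ ω : Config F ι, Separates M (agreement ω.2) →
      ((univ.filter fun ω' => ∀ i ∈ vA ∪ vB, quadruple s w i ω' = quadruple s w i ω).card : ℝ) ≤
        m) :
    (4 * vectorBits F ι - Real.logb 2 m) - 4 * vectorBits F ι * failureRate M ≤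
      (uniformProfile (quadruple s w)).H (vA ∪ vB) := by
  have hV := card_vector_pos F ι
  have hm0 : 0 < m := by linarith
  rw [uniformProfile_H _ (by simp)]
  refine le_trans ?_ (le_fiberEntropy_of_fiberCard_le
    (univ.filter fun ω : Config F ι => Separates M (agreement ω.2)) (m := m) fun ω hω => ?_)
  swap
  · refine le_trans (le_of_eq ?_) (h ω (mem_filter.1 hω).2)
    simp only [fiberCard, funext_iff, Subtype.forall]
  have hG : (univ.filter fun ω : Config F ι => Separates M (agreement ω.2)) =
      univ ×ˢ (univ.filter fun x : (ι → F) × (ι → F) => Separates M (agreement x)) := by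
    ext; simp
  have hsum := card_filter_add_card_filter_not (s := (univ : Finset ((ι → F) × (ι → F))))
    (fun x => Separates M (agreement x))
  have hgood : ((univ.filter fun x : (ι → F) × (ι → F) => Separates M (agreement x)).card : ℝ) =
      (Fintype.card (ι → F) : ℝ) ^ 2 * (1 - failureRate M) := by
    rw [failureRate, mul_sub, mul_div_cancel₀ _ (by positivity), mul_one, eq_sub_iff_add_eq, sq]
    rw [card_univ, Fintype.card_prod] at hsum
    exact_mod_cast hsum
  have hlog : Real.logb 2 ((Fintype.card (Config F ι) : ℝ) / m) =
      4 * vectorBits F ι - Real.logb 2 m := by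
    simp only [Fintype.card_prod, Nat.cast_mul, vectorBits]
    rw [Real.logb_div (by positivity) (by positivity), Real.logb_mul (by positivity) (by positivity),
      Real.logb_mul (by positivity) (by positivity)]
    ring
  have hfrac : ((univ.filter fun ω : Config F ι => Separates M (agreement ω.2)).card : ℝ) /
      Fintype.card (Config F ι) = 1 - failureRate M := by
    rw [hG, card_product, Nat.cast_mul, hgood, card_univ]
    simp only [Fintype.card_prod, Nat.cast_mul]
    field_simp
  rw [hlog, hfrac]
  -- Allows log m to be subtracted in full rather than weighted by the success probability.
  have h1 : 0 ≤ failureRate M * Real.logb 2 m :=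
    mul_nonneg (failureRate_nonneg M) (Real.logb_nonneg (by norm_num) hm)
  linarith

end Entropies

/-! ### The quadruple for (I1): ordinates modulo the row space -/

section HashedOrdinate

/-- The row space of a matrix. -/
def rowSpace (M : Matrix (Fin r) ι F) : Submodule F (ι → F) := LinearMap.range M.vecMulLinear

/-- A representative of the class of a vector modulo the row space. -/
def reduceMod (M : Matrix (Fin r) ι F) (y : ι → F) : ι → F :=
  Quotient.out (Submodule.Quotient.mk y : (ι → F) ⧸ rowSpace M)

theorem mk_reduceMod (M : Matrix (Fin r) ι F) (y : ι → F) :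
    (Submodule.Quotient.mk (reduceMod M y) : (ι → F) ⧸ rowSpace M) = Submodule.Quotient.mk y :=
  Quotient.out_eq _

theorem reduceMod_eq_iff (M : Matrix (Fin r) ι F) (y z : ι → F) :
    reduceMod M y = reduceMod M z ↔
      (Submodule.Quotient.mk y : (ι → F) ⧸ rowSpace M) = Submodule.Quotient.mk z := by
  constructor
  · intro h
    rw [← mk_reduceMod, h, mk_reduceMod]
  · intro h
    rw [reduceMod, h, reduceMod]

theorem sub_reduceMod_mem (M : Matrix (Fin r) ι F) (y : ι → F) :
    y - reduceMod M y ∈ rowSpace M :=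
  (Submodule.Quotient.eq _).1 (mk_reduceMod M y).symm

/-- The quadruple in which the ordinates of `A` are only known modulo the row space of `M`. -/
abbrev hashedOrdinate (M : Matrix (Fin r) ι F) :
    Fin 4 → Config F ι → (ι → F) × (ι → F) × (Fin r → F) :=
  quadruple (reduceMod M) fun _ => 0

open scoped Classical in
theorem card_quotient_mul_card_rowSpace (M : Matrix (Fin r) ι F) :
    Fintype.card ((ι → F) ⧸ rowSpace M) * Fintype.card (rowSpace M) = Fintype.card (ι → F) := by
  have := (rowSpace M).card_eq_card_quotient_mul_card
  simp only [Nat.card_eq_fintype_card] at this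
  rw [this, mul_comm]

open scoped Classical in
/-- The dimension of the row space, in bits. -/
def rowSpaceBits (M : Matrix (Fin r) ι F) : ℝ := Real.logb 2 (Fintype.card (rowSpace M))

theorem rowSpaceBits_le (M : Matrix (Fin r) ι F) :
    rowSpaceBits M ≤ r * Real.logb 2 (Fintype.card F) := by
  classical
  rw [rowSpaceBits, ← Real.logb_pow]
  have h1 : Fintype.card (rowSpace M) ≤ Fintype.card F ^ r := by
    have := Fintype.card_le_of_surjective _ M.vecMulLinear.surjective_rangeRestrict
    rw [Fintype.card_fun, Fintype.card_fin] at this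
    convert this
    rfl
  have h2 : 0 < Fintype.card (rowSpace M) := Fintype.card_pos
  exact Real.logb_le_logb_of_le (by norm_num) (by exact_mod_cast h2) (by exact_mod_cast h1)

open scoped Classical in
theorem logb_card_quotient (M : Matrix (Fin r) ι F) :
    Real.logb 2 (Fintype.card ((ι → F) ⧸ rowSpace M)) = vectorBits F ι - rowSpaceBits M := by
  have h1 : (0 : ℝ) < Fintype.card ((ι → F) ⧸ rowSpace M) := by exact_mod_cast Fintype.card_pos
  have h2 : (0 : ℝ) < Fintype.card (rowSpace M) := by exact_mod_cast Fintype.card_pos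
  rw [vectorBits, rowSpaceBits, ← card_quotient_mul_card_rowSpace M, Nat.cast_mul,
    Real.logb_mul h1.ne' h2.ne', add_sub_cancel_right]

/-- The hash erases exactly the row-space component. For the lower bound, the erased information is
the difference between the ordinate vector and its representative. -/
theorem hashedOrdinate_H_A (M : Matrix (Fin r) ι F) :
    (uniformProfile (hashedOrdinate M)).H vA = 2 * vectorBits F ι - rowSpaceBits M := by
  classical
  have hV := card_vector_pos F ι
  refine le_antisymm ?_ ?_
  · refine (uniformProfile_H_le (γ := (ι → F) × ((ι → F) ⧸ rowSpace M)) (by simp)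
      (fun ω => (ω.2.1, Submodule.Quotient.mk (ω.1.1 + ω.1.2 * ω.2.1))) ?_).trans (le_of_eq ?_)
    · rintro ⟨⟨c, d⟩, x, y⟩ ⟨⟨c', d'⟩, x', y'⟩ h
      simp only [Prod.mk.injEq, ← reduceMod_eq_iff] at h
      simpa [quadruple] using h
    · have h1 : (0 : ℝ) < Fintype.card ((ι → F) ⧸ rowSpace M) := by
        exact_mod_cast Fintype.card_pos
      rw [Fintype.card_prod, Nat.cast_mul, Real.logb_mul hV.ne' h1.ne', logb_card_quotient,
        vectorBits]
      ring
  · refine (le_of_eq ?_).trans (le_uniformProfile_H (γ := (ι → F) × (ι → F) × rowSpace M) (by simp)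
      (fun ω => (ω.1.2, ω.2.2, ⟨_, sub_reduceMod_mem M (ω.1.1 + ω.1.2 * ω.2.1)⟩)) ?_)
    · have h1 : (0 : ℝ) < Fintype.card (rowSpace M) := by exact_mod_cast Fintype.card_pos
      simp only [Fintype.card_prod, Nat.cast_mul, vectorBits, rowSpaceBits]
      rw [Real.logb_div (by positivity) (by positivity),
        Real.logb_mul (by positivity) (by positivity),
        Real.logb_mul (by positivity) (by positivity),
        Real.logb_mul (by positivity) (by positivity),
        Real.logb_mul (by positivity) (by positivity)]
      ring
    · rintro ⟨⟨c, d⟩, x, y⟩ ⟨⟨c', d'⟩, x', y'⟩ h h'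
      simp [quadruple] at h h'
      obtain ⟨rfl, h⟩ := h
      obtain ⟨rfl, rfl, h'⟩ := h'
      rw [h] at h'
      simpa using h'

theorem hashedOrdinate_H_AB_le (M : Matrix (Fin r) ι F) :
    (uniformProfile (hashedOrdinate M)).H (vA ∪ vB) ≤ 4 * vectorBits F ι - rowSpaceBits M := by
  classical
  have hV := card_vector_pos F ι
  refine (uniformProfile_H_le
      (γ := ((ι → F) × ((ι → F) ⧸ rowSpace M)) × (ι → F) × (ι → F)) (by simp)
      (fun ω => ((ω.2.1, Submodule.Quotient.mk (ω.1.1 + ω.1.2 * ω.2.1)),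
        ω.2.2, ω.1.1 + ω.1.2 * ω.2.2)) ?_).trans (le_of_eq ?_)
  · rintro ⟨⟨c, d⟩, x, y⟩ ⟨⟨c', d'⟩, x', y'⟩ h
    simp only [Prod.mk.injEq, ← reduceMod_eq_iff] at h
    obtain ⟨⟨rfl, h1⟩, rfl, h2⟩ := h
    simp [quadruple, h1, h2]
  · have h1 : (0 : ℝ) < Fintype.card ((ι → F) ⧸ rowSpace M) := by
      exact_mod_cast Fintype.card_pos
    simp only [Fintype.card_prod, Nat.cast_mul]
    rw [Real.logb_mul (by positivity) (by positivity), Real.logb_mul hV.ne' h1.ne',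
      Real.logb_mul (by positivity) (by positivity), logb_card_quotient, vectorBits]
    ring

theorem hashedOrdinate_H_DA_le (M : Matrix (Fin r) ι F) :
    (uniformProfile (hashedOrdinate M)).H (vD ∪ vA) ≤ 3 * vectorBits F ι := by
  refine quadruple_H_le_three _ _ (by simp)
    (fun ω => (ω.1.1 + ω.2.1 * ω.2.2, ω.1.2 - (ω.2.1 + ω.2.2), ω.2.1)) ?_
  rintro ⟨⟨c, d⟩, x, y⟩ ⟨⟨c', d'⟩, x', y'⟩ h
  simp only [Prod.mk.injEq] at h
  obtain ⟨h1, h2, rfl⟩ := h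
  have h3 : c + d * x = c' + d' * x := by
    rw [ordinate_eq c d x y, ordinate_eq c' d' x y', h1, h2]
  simp [quadruple, h1, h2, h3]

/-- The ordinates of `B`, and those of `A` modulo the row space of `M`, as a function of the
coefficients of the line. -/
def ordinatesHom (M : Matrix (Fin r) ι F) (x : (ι → F) × (ι → F)) :
    (ι → F) × (ι → F) →+ (ι → F) × ((ι → F) ⧸ rowSpace M) where
  toFun c := (c.1 + c.2 * x.2, Submodule.Quotient.mk (c.1 + c.2 * x.1))
  map_zero' := by simp
  map_add' c d := by
    simp only [Prod.fst_add, Prod.snd_add, Prod.mk_add_mk, ← Submodule.Quotient.mk_add]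
    exact Prod.ext (by ring) (congrArg Submodule.Quotient.mk (by ring))

/-- Where the abscissas differ, a line passes through any two prescribed points. Where they agree,
the ordinates have to agree too, and separation supplies a row-space correction that makes them. -/
theorem ordinatesHom_surjective {M : Matrix (Fin r) ι F} {x : (ι → F) × (ι → F)}
    (h : Separates M (agreement x)) : Function.Surjective (ordinatesHom M x) := by
  rintro ⟨y, z⟩
  obtain ⟨z, rfl⟩ := Submodule.Quotient.mk_surjective _ z
  obtain ⟨v, hv⟩ := h.exists_vecMul_eq (y - z)
  have hmem : v ᵥ* M ∈ rowSpace M := ⟨v, rfl⟩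
  set z' : ι → F := z + v ᵥ* M with hz'
  have hz : (Submodule.Quotient.mk z : (ι → F) ⧸ rowSpace M) = Submodule.Quotient.mk z' := by
    rw [Submodule.Quotient.eq, hz', sub_add_cancel_left]
    exact neg_mem hmem
  -- The slope through the two points; at a coincidence, division by zero gives slope 0, which is
  -- harmless because `z'` and `y` agree there.
  let d : ι → F := fun i => (z' i - y i) / (x.1 i - x.2 i)
  refine ⟨(y - d * x.2, d), ?_⟩
  rw [hz]
  simp only [ordinatesHom, AddMonoidHom.coe_mk, ZeroHom.coe_mk, sub_add_cancel, Prod.mk.injEq,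
    true_and]
  congr 1
  funext i
  simp only [Pi.add_apply, Pi.sub_apply, Pi.mul_apply, d]
  by_cases hi : x.1 i = x.2 i
  · have := hv i (by simp [agreement, hi])
    have h2 : z' i = y i := by
      rw [hz', Pi.add_apply, this, Pi.sub_apply]
      ring
    simp [hi, h2]
  · have : x.1 i - x.2 i ≠ 0 := sub_ne_zero.2 hi
    field_simp
    ring

/-- `A` and `B` fix the abscissas, so the fibre is one of `ordinatesHom`; when that map is
surjective, all its fibres have the size of the row space. -/
theorem le_hashedOrdinate_H_AB (M : Matrix (Fin r) ι F) :
    (4 * vectorBits F ι - rowSpaceBits M) - 4 * vectorBits F ι * failureRate M ≤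
      (uniformProfile (hashedOrdinate M)).H (vA ∪ vB) := by
  classical
  refine le_quadruple_H_AB _ _ (by exact_mod_cast Nat.succ_le_of_lt Fintype.card_pos) ?_
  intro ω hω
  have h1 := card_fiber_mul_card _ (ordinatesHom_surjective hω) (ordinatesHom M ω.2 ω.1)
  have h2 : (univ.filter fun c => ordinatesHom M ω.2 c = ordinatesHom M ω.2 ω.1).card =
      Fintype.card (rowSpace M) := by
    refine Nat.eq_of_mul_eq_mul_right (m := Fintype.card ((ι → F) × ((ι → F) ⧸ rowSpace M)))
      Fintype.card_pos (Eq.trans ?_ (h1.trans ?_))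
    · congr!
    · rw [Fintype.card_prod, Fintype.card_prod, mul_left_comm, mul_comm (Fintype.card (rowSpace M)),
        card_quotient_mul_card_rowSpace]
  rw [← h2, Nat.cast_le]
  obtain ⟨⟨c', d'⟩, x', y'⟩ := ω
  refine card_le_card_of_injOn (fun ω => ω.1) ?_ ?_
  · rintro ⟨⟨c, d⟩, x, y⟩ h
    simp [quadruple, reduceMod_eq_iff] at h
    obtain ⟨⟨rfl, h3⟩, rfl, h4⟩ := h
    simpa [ordinatesHom, h4] using h3
  · rintro ⟨⟨c, d⟩, x, y⟩ h ⟨⟨c₁, d₁⟩, x₁, y₁⟩ h₁ h₂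
    simp [quadruple] at h h₁ h₂
    simp [h, h₁, h₂]

theorem hashedOrdinate_I_nonneg (M : Matrix (Fin r) ι F) :
    0 ≤ (uniformProfile (hashedOrdinate M)).I vA vB := by
  have := hashedOrdinate_H_AB_le M
  rw [Point.I, hashedOrdinate_H_A, quadruple_H_B]
  linarith

theorem hashedOrdinate_I_le (M : Matrix (Fin r) ι F) :
    (uniformProfile (hashedOrdinate M)).I vA vB ≤ 4 * vectorBits F ι * failureRate M := by
  have := le_hashedOrdinate_H_AB M
  rw [Point.I, hashedOrdinate_H_A, quadruple_H_B]
  linarith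

theorem hashedOrdinate_box_le (M : Matrix (Fin r) ι F) :
    (uniformProfile (hashedOrdinate M)).box vA vB vC vD ≤
      Fintype.card ι * Real.logb 2 (Fintype.card (Sym2 F)) - 2 * vectorBits F ι +
        r * Real.logb 2 (Fintype.card F) + 4 * vectorBits F ι * failureRate M := by
  have h1 := quadruple_box_le (reduceMod M) fun _ => (0 : Fin r → F)
  have h2 := le_hashedOrdinate_H_AB M
  have h3 := hashedOrdinate_H_DA_le M
  have h4 := rowSpaceBits_le M
  linarith

end HashedOrdinate

/-! ### The quadruple for (I3): a hash of the slope -/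

section HashedSlope

/-- The quadruple in which `A` is completed by the image under `M` of the slopes of the lines. -/
abbrev hashedSlope (M : Matrix (Fin r) ι F) :
    Fin 4 → Config F ι → (ι → F) × (ι → F) × (Fin r → F) :=
  quadruple id fun d => M *ᵥ d

theorem le_hashedSlope_H_AB (M : Matrix (Fin r) ι F) :
    4 * vectorBits F ι - 4 * vectorBits F ι * failureRate M ≤
      (uniformProfile (hashedSlope M)).H (vA ∪ vB) := by
  classical
  have := le_quadruple_H_AB (M := M) id (fun d => M *ᵥ d) le_rfl ?_
  · simpa using this
  rintro ⟨⟨c', d'⟩, x', y'⟩ hω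
  rw [Nat.cast_le_one, card_le_one_iff_subset_singleton]
  refine ⟨((c', d'), x', y'), ?_⟩
  rintro ⟨⟨c, d⟩, x, y⟩ h
  simp [quadruple] at h
  obtain ⟨⟨rfl, h1, h2⟩, rfl, h3⟩ := h
  -- Two lines through the same points can differ in slope only at coincidences, and the hash says
  -- that `M` kills the difference.
  have hd : d - d' = 0 := by
    refine hω _ (fun i hi => ?_) (by rw [Matrix.mulVec_sub, h2, sub_self])
    have hxy : x i - y i ≠ 0 := sub_ne_zero.2 (by simpa [agreement] using hi)
    refine (mul_eq_zero.1 ?_).resolve_right hxy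
    have h4 := congrFun h1 i
    have h5 := congrFun h3 i
    simp only [Pi.add_apply, Pi.mul_apply, Pi.sub_apply] at h4 h5 ⊢
    linear_combination h4 - h5
  rw [sub_eq_zero] at hd
  subst hd
  simpa using h1

theorem hashedSlope_H_DA_le (M : Matrix (Fin r) ι F) :
    (uniformProfile (hashedSlope M)).H (vD ∪ vA) ≤
      3 * vectorBits F ι + r * Real.logb 2 (Fintype.card F) := by
  refine (uniformProfile_H_le (γ := ((ι → F) × (ι → F) × (ι → F)) × (Fin r → F)) (by simp)
    (fun ω => ((ω.1.1 + ω.2.1 * ω.2.2, ω.1.2 - (ω.2.1 + ω.2.2), ω.2.1), M *ᵥ ω.1.2))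
    ?_).trans (le_of_eq ?_)
  · rintro ⟨⟨c, d⟩, x, y⟩ ⟨⟨c', d'⟩, x', y'⟩ h
    simp only [Prod.mk.injEq] at h
    obtain ⟨⟨h1, h2, rfl⟩, h4⟩ := h
    have h3 : c + d * x = c' + d' * x := by
      rw [ordinate_eq c d x y, ordinate_eq c' d' x y', h1, h2]
    simp [quadruple, h1, h2, h3, h4]
  · have hV := card_vector_pos F ι
    have hW := card_vector_pos F (Fin r)
    simp only [Fintype.card_prod, Nat.cast_mul, vectorBits]
    rw [Real.logb_mul (by positivity) (by positivity),
      Real.logb_mul (by positivity) (by positivity),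
      Real.logb_mul (by positivity) (by positivity), Fintype.card_fun (α := Fin r),
      Fintype.card_fin, Nat.cast_pow, Real.logb_pow]
    ring

theorem hashedSlope_condH_nonneg (M : Matrix (Fin r) ι F) :
    0 ≤ (uniformProfile (hashedSlope M)).condH vC (vA ∪ vB) := by
  have := quadruple_H_le id (fun d => M *ᵥ d) (vA ∪ vB) (by simp)
  rw [Point.condH, Finset.union_comm, quadruple_H_ABC]
  linarith

theorem hashedSlope_condH_le (M : Matrix (Fin r) ι F) :
    (uniformProfile (hashedSlope M)).condH vC (vA ∪ vB) ≤
      4 * vectorBits F ι * failureRate M := by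
  have := le_hashedSlope_H_AB M
  rw [Point.condH, Finset.union_comm, quadruple_H_ABC]
  linarith

theorem hashedSlope_box_le (M : Matrix (Fin r) ι F) :
    (uniformProfile (hashedSlope M)).box vA vB vC vD ≤
      Fintype.card ι * Real.logb 2 (Fintype.card (Sym2 F)) - 2 * vectorBits F ι +
        r * Real.logb 2 (Fintype.card F) + 4 * vectorBits F ι * failureRate M := by
  have h1 := quadruple_box_le id fun d => M *ᵥ d
  have h2 := le_hashedSlope_H_AB M
  have h3 := hashedSlope_H_DA_le M
  linarith

end HashedSlope

end LinesAndParabolas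

/-! ### Numerical parameters and the limit points -/

section Conclusion

instance fact_prime_seventeen : Fact (Nat.Prime 17) := ⟨by norm_num⟩

/-- The index set of the `k`-th quadruple. -/
abbrev Idx (k : ℕ) : Type := Fin (17 * (k + 2))

theorem failureRate_le {k : ℕ} {M : Matrix (Fin (2 * (k + 2))) (Idx k) (ZMod 17)}
    (hM : failureRate M * 2 ^ (2 * (k + 2)) ≤ (18 / 17 : ℝ) ^ (17 * (k + 2))) :
    failureRate M ≤ (3 / 4 : ℝ) ^ k := by
  rw [pow_mul, pow_mul] at hM
  -- Since (1 + 1/17)^17 < e < 3, two hash symbols per block of 17 indices, weighing 2^2 = 4,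
  -- suffice.
  have h1 : ((18 / 17 : ℝ) ^ 17) ^ (k + 2) ≤ 3 ^ (k + 2) := by gcongr; norm_num
  have h2 : failureRate M ≤ (3 / 4 : ℝ) ^ (k + 2) := by
    rw [div_pow, le_div_iff₀ (by positivity)]
    norm_num at hM h1 ⊢
    exact hM.trans h1
  exact h2.trans (pow_le_pow_of_le_one (by norm_num) (by norm_num) (by omega))

theorem exists_matrix_failureRate_le (k : ℕ) :
    ∃ M : Matrix (Fin (2 * (k + 2))) (Idx k) (ZMod 17), failureRate M ≤ (3 / 4 : ℝ) ^ k := by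
  classical
  obtain ⟨M, hM⟩ := exists_matrix_separates (ZMod 17) (Idx k) (2 * (k + 2))
  refine ⟨M, failureRate_le ?_⟩
  rw [ZMod.card, Fintype.card_fin] at hM
  have hM' : (((Finset.univ.filter fun x : (Idx k → ZMod 17) × (Idx k → ZMod 17) =>
      ¬ Separates M (agreement x)).card : ℝ)) * 2 ^ (2 * (k + 2)) ≤
      (17 ^ 2 + 17) ^ (17 * (k + 2)) := by exact_mod_cast hM
  have hV := card_vector_pos (ZMod 17) (Idx k)
  rw [failureRate, div_mul_eq_mul_div, div_le_iff₀ (by positivity)]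
  refine hM'.trans (le_of_eq ?_)
  rw [Fintype.card_fun, ZMod.card, Fintype.card_fin]
  push_cast
  rw [← pow_mul, mul_comm (17 * (k + 2)) 2, pow_mul (17 : ℝ), ← mul_pow]
  norm_num

/-- The gap, per block of `17` indices, in the box inequality. -/
def boxGap : ℝ := 17 * (Real.logb 2 289 - Real.logb 2 153) - 2 * Real.logb 2 17

theorem boxGap_pos : 0 < boxGap := by
  have : boxGap = Real.logb 2 ((289 / 153) ^ 17 / 17 ^ 2) := by
    rw [Real.logb_div (by norm_num) (by norm_num), Real.logb_pow, Real.logb_pow,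
      Real.logb_div (by norm_num) (by norm_num), boxGap]
    norm_num
  rw [this]
  exact Real.logb_pos (by norm_num) (by norm_num)

theorem vectorBits_eq (k : ℕ) :
    vectorBits (ZMod 17) (Idx k) = 17 * ((k : ℝ) + 2) * Real.logb 2 17 := by
  rw [vectorBits, Fintype.card_fun, ZMod.card, Fintype.card_fin, Nat.cast_pow, Real.logb_pow]
  push_cast
  ring

theorem box_bound_eq (k : ℕ) :
    Fintype.card (Idx k) * Real.logb 2 (Fintype.card (Sym2 (ZMod 17))) -
      2 * vectorBits (ZMod 17) (Idx k) +
        (2 * (k + 2) : ℕ) * Real.logb 2 (Fintype.card (ZMod 17)) = -boxGap * ((k : ℝ) + 2) := by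
  -- Unordered pairs with repetition: 18 · 17 / 2.
  have h1 : Fintype.card (Sym2 (ZMod 17)) = 153 := by
    rw [Sym2.card, ZMod.card]
    rfl
  have h2 : Real.logb 2 289 = 2 * Real.logb 2 17 := by
    rw [show (289 : ℝ) = 17 ^ 2 by norm_num, Real.logb_pow]
    norm_num
  rw [vectorBits_eq, h1, boxGap, h2, ZMod.card, Fintype.card_fin]
  push_cast
  ring

namespace Point

variable {n : ℕ}

theorem continuous_H (S : Finset (Fin n)) : Continuous fun h : Point n => h.H S := by
  unfold H
  split_ifs <;> fun_prop

theorem H_div (h : Point n) (c : ℝ) (S : Finset (Fin n)) :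
    H (fun T => h T / c) S = h.H S / c := by
  unfold H
  split_ifs <;> simp

theorem continuous_I (S T : Finset (Fin n)) : Continuous fun h : Point n => h.I S T := by
  have := continuous_H (n := n)
  unfold I
  fun_prop

theorem continuous_condH (S T : Finset (Fin n)) : Continuous fun h : Point n => h.condH S T := by
  have := continuous_H (n := n)
  unfold condH
  fun_prop

theorem continuous_condI (S T U : Finset (Fin n)) :
    Continuous fun h : Point n => h.condI S T U := by
  have := continuous_H (n := n)
  unfold condI
  fun_prop

theorem continuous_box (A B C D : Finset (Fin n)) :
    Continuous fun h : Point n => h.box A B C D := by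
  have := continuous_I (n := n)
  have := continuous_condI (n := n)
  unfold box
  fun_prop

theorem I_div (h : Point n) (c : ℝ) (S T : Finset (Fin n)) :
    I (fun U => h U / c) S T = h.I S T / c := by
  simp only [I, H_div]
  ring

theorem condH_div (h : Point n) (c : ℝ) (S T : Finset (Fin n)) :
    condH (fun U => h U / c) S T = h.condH S T / c := by
  simp only [condH, H_div]
  ring

theorem condI_div (h : Point n) (c : ℝ) (S T U : Finset (Fin n)) :
    condI (fun V => h V / c) S T U = h.condI S T U / c := by
  simp only [condI, H_div]
  ring

theorem box_div (h : Point n) (c : ℝ) (A B C D : Finset (Fin n)) :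
    box (fun V => h V / c) A B C D = h.box A B C D / c := by
  simp only [box, I_div, condI_div]
  ring

end Point

/-- A family of quadruples with `I(A : B | C) = 0`, a negative box expression of linear size, and a
further quantity `J` that vanishes asymptotically, has a limit point at which `J` vanishes. -/
theorem exists_almostEntropic_of_family (M : ∀ k, Matrix (Fin (2 * (k + 2))) (Idx k) (ZMod 17))
    (hM : ∀ k, failureRate (M k) ≤ (3 / 4 : ℝ) ^ k)
    (s : ∀ k, (Idx k → ZMod 17) → Idx k → ZMod 17)
    (w : ∀ k, (Idx k → ZMod 17) → Fin (2 * (k + 2)) → ZMod 17)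
    (J : Point 4 → ℝ) (hJ : Continuous J)
    (hJdiv : ∀ (h : Point 4) (c : ℝ), J (fun S => h S / c) = J h / c)
    (hJ₀ : ∀ k, 0 ≤ J (uniformProfile (quadruple (s k) (w k))))
    (hJ₁ : ∀ k, J (uniformProfile (quadruple (s k) (w k))) ≤
      4 * vectorBits (ZMod 17) (Idx k) * failureRate (M k))
    (hbox : ∀ k, (uniformProfile (quadruple (s k) (w k))).box vA vB vC vD ≤
      Fintype.card (Idx k) * Real.logb 2 (Fintype.card (Sym2 (ZMod 17))) -
        2 * vectorBits (ZMod 17) (Idx k) +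
        (2 * (k + 2) : ℕ) * Real.logb 2 (Fintype.card (ZMod 17)) +
        4 * vectorBits (ZMod 17) (Idx k) * failureRate (M k)) :
    ∃ h ∈ almostEntropicPoints 4, h.condI vA vB vC = 0 ∧ J h = 0 ∧ h.box vA vB vC vD < 0 := by
  set e : ℕ → Point 4 := fun k => uniformProfile (quadruple (s k) (w k)) with he
  set L : ℝ := Real.logb 2 17 with hL
  have hL0 : 0 ≤ L := Real.logb_nonneg (by norm_num) (by norm_num)
  -- The error is a linear factor times a geometric one, and the linear factor is what the scaling
  -- removes; 68 = 4 · 17.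
  have herr : ∀ k, 4 * vectorBits (ZMod 17) (Idx k) * failureRate (M k) ≤
      (68 * L * (3 / 4 : ℝ) ^ k) * ((k : ℝ) + 2) := by
    intro k
    rw [vectorBits_eq]
    calc 4 * (17 * ((k : ℝ) + 2) * Real.logb 2 17) * failureRate (M k)
        ≤ 4 * (17 * ((k : ℝ) + 2) * L) * (3 / 4 : ℝ) ^ k := by gcongr; exact hM k
      _ = _ := by ring
  obtain ⟨h, hmem, φ, hφ, hlim⟩ := exists_almostEntropic_limit e (68 * L)
    (fun k => ⟨_, _, inferInstance, inferInstance, inferInstance, _, rfl⟩) (by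
      intro k S
      have h1 := quadruple_H_le (s k) (w k) S.1 S.2
      rw [uniformProfile_H _ S.2, vectorBits_eq] at h1
      refine (show e k S ≤ _ from h1).trans (le_of_eq ?_)
      rw [hL]
      ring)
  have hlim' : Tendsto (fun j => (fun S => e (φ j) S / ((φ j : ℝ) + 2) : Point 4)) atTop (𝓝 h) :=
    tendsto_pi_nhds.2 hlim
  have hzero : Tendsto (fun j => 68 * L * (3 / 4 : ℝ) ^ φ j) atTop (𝓝 0) := by
    have := ((tendsto_pow_atTop_nhds_zero_of_lt_one (r := (3 / 4 : ℝ)) (by norm_num)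
      (by norm_num)).comp hφ.tendsto_atTop).const_mul (68 * L)
    simpa using this
  refine ⟨h, hmem, ?_, ?_, ?_⟩
  · have h1 := ((Point.continuous_condI vA vB vC).tendsto h).comp hlim'
    refine tendsto_nhds_unique h1 (tendsto_const_nhds.congr fun j => ?_)
    rw [Function.comp_apply, Point.condI_div, he, quadruple_condI_eq_zero, zero_div]
  · refine tendsto_nhds_unique ((hJ.tendsto h).comp hlim') (squeeze_zero (fun j => ?_)
      (fun j => ?_) hzero)
    · rw [Function.comp_apply, hJdiv]
      exact div_nonneg (hJ₀ _) (by positivity)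
    · rw [Function.comp_apply, hJdiv, div_le_iff₀ (by positivity)]
      exact (hJ₁ _).trans (herr _)
  · have h1 := ((Point.continuous_box vA vB vC vD).tendsto h).comp hlim'
    have h2 : Tendsto (fun j => -boxGap + 68 * L * (3 / 4 : ℝ) ^ φ j) atTop (𝓝 (-boxGap + 0)) :=
      hzero.const_add _
    have h3 : h.box vA vB vC vD ≤ -boxGap + 0 := by
      refine le_of_tendsto_of_tendsto' h1 h2 fun j => ?_
      rw [Function.comp_apply, Point.box_div, div_le_iff₀ (by positivity)]
      have h4 := hbox (φ j)
      rw [box_bound_eq] at h4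
      have h5 := herr (φ j)
      simp only [he] at h4 ⊢
      linarith
    have := boxGap_pos
    linarith

end Conclusion

end InfoIneq

end

theorem theorem5 :
    (∃ h : InfoIneq.Point 4, h ∈ InfoIneq.almostEntropicPoints 4 ∧
      InfoIneq.SatisfiesAllLinearInequalities h ∧ ¬ InfoIneq.SatisfiesI1 h) ∧
    (∃ h : InfoIneq.Point 4, h ∈ InfoIneq.almostEntropicPoints 4 ∧
      InfoIneq.SatisfiesAllLinearInequalities h ∧ ¬ InfoIneq.SatisfiesI3 h) := by
  choose M hM using InfoIneq.exists_matrix_failureRate_le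
  constructor
  · obtain ⟨h, hmem, h1, h2, h3⟩ := InfoIneq.exists_almostEntropic_of_family M hM
      (fun k => InfoIneq.reduceMod (M k)) (fun _ _ => 0)
      (fun h => h.I InfoIneq.vA InfoIneq.vB) (InfoIneq.Point.continuous_I _ _)
      (fun h c => InfoIneq.Point.I_div h c _ _)
      (fun k => InfoIneq.hashedOrdinate_I_nonneg (M k))
      (fun k => InfoIneq.hashedOrdinate_I_le (M k))
      (fun k => InfoIneq.hashedOrdinate_box_le (M k))
    exact ⟨h, hmem, InfoIneq.satisfiesAllLinearInequalities_of_mem hmem,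
      fun hI => absurd (hI ⟨h1, h2⟩) (not_le.2 h3)⟩
  · obtain ⟨h, hmem, h1, h2, h3⟩ := InfoIneq.exists_almostEntropic_of_family M hM
      (fun _ => id) (fun k d => (M k).mulVec d)
      (fun h => h.condH InfoIneq.vC (InfoIneq.vA ∪ InfoIneq.vB))
      (InfoIneq.Point.continuous_condH _ _)
      (fun h c => InfoIneq.Point.condH_div h c _ _)
      (fun k => InfoIneq.hashedSlope_condH_nonneg (M k))
      (fun k => InfoIneq.hashedSlope_condH_le (M k))
      (fun k => InfoIneq.hashedSlope_box_le (M k))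
    exact ⟨h, hmem, InfoIneq.satisfiesAllLinearInequalities_of_mem hmem,
      fun hI => absurd (hI ⟨h1, h2⟩) (not_le.2 h3)⟩
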